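/- Let $B$ be a definite quaternion algebra over $\mathbb{Q}$ of discriminant $N$ (the product of the finite primes ramified in $B$), and let $\mathcal{O}$ be a maximal order in $B$. Write $B_p = B\otimes\mathbb{Q}_p$, $\mathcal{O}_p=\mathcal{O}\otimes\mathbb{Z}_p$, let $\hat{\mathcal O}^\times=\prod_p\mathcal{O}_p^\times$, let $\hat B^\times$ be the restricted product of the $B_p^\times$ with respect to the $\mathcal{O}_p^\times$, let $\mathrm{Cl}(\mathcal{O}) = B^\times\backslash\hat B^\times/\hat{\mathcal O}^\times$ (the finite set of invertible right $\mathcal{O}$-ideal classes), and let $M(\mathcal{O})$ be the space of functions $\mathrm{Cl}(\mathcal{O})\to\mathbb{C}$. For $\alpha\in\hat B^\times$ put $(T_\alpha\phi)(x)=\sum_\beta\phi(x\beta)$, where $\hat{\mathcal O}^\times\alpha\hat{\mathcal O}^\times=\bigsqcup_\beta \beta\hat{\mathcal O}^\times$, and for $n\ge 1$ let $T_n$ be the sum of the $T_\alpha$ over representatives $\alpha$ of the double cosets $\hat{\mathcal O}^\times\alpha\hat{\mathcal O}^\times$ in $\hat B^\times$ consisting of elements whose components lie in the $\mathcal{O}_p$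 and whose reduced norm generates $n\hat{\mathbb{Z}}$. An eigenform is a nonzero $\phi\in M(\mathcal{O})$ that is an eigenvector of $T_p$ for every prime $p\nmid N$. Its degree is $[K_\phi:\mathbb{Q}]$, where $K_\phi$ is the field generated by all eigenvalues of $\phi$ under those $T_n$ of which it is an eigenvector. For $p\mid N$ let $\varpi_p$ be a uniformizer of $\mathcal{O}_p$ with $\varpi_p^2=p$, let $\hat\varpi_p\in\hat B^\times$ be the element with component $\varpi_p$ at $p$ and $1$ elsewhere, and let $\sigma_p$ be the involution of $\mathrm{Cl}(\mathcal{O})$ given by right multiplication by $\hat\varpi_p$. Let $\varepsilon$ be a sign pattern for $N$, i.e. a multiplicative function from the divisors of $N$ to $\{\pm1\}$, and let $M^\varepsilon(\mathcal{O})=\{\phi\in M(\mathcal{O}): T_{\hat\varpi_p}\phi=\varepsilon(p)\phi \text{ for all } p\mid N\}$. Consider the signed multigraph on $\mathrm{Cl}(\mathcal{O})$ with an edge of sign $\varepsilon(p)$ between $x$ and $\sigma_p(x)$ for every $p\mid N$ and every orbit $\{x,\sigma_p(x)\}$ of $\sigma_p$. An orbit of the group generated by the $\sigma_p$, $p\mid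 N$ (equivalently, a connected component of the graph) is called $\varepsilon$-admissible if it contains no closed path whose edge signs multiply to $-1$. Let $\mathcal{F}_\varepsilon$ be any set of representatives of the $\varepsilon$-admissible orbits. A zero $x\in\mathrm{Cl}(\mathcal{O})$ of $\phi \in M^\varepsilon(\mathcal{O})$ is called trivial if the orbit of $x$ is not $\varepsilon$-admissible, and nontrivial otherwise. If $\phi\in M^\varepsilon(\mathcal{O})$ is an eigenform of degree $d$, then $\phi$ vanishes on at most $\#\mathcal{F}_\varepsilon-d$ points of $\mathcal{F}_\varepsilon$. Moreover $\phi$ has at most $2^{\omega(N)}\bigl(\dim_{\mathbb C} M^\varepsilon(\mathcal{O})-d\bigr)$ nontrivial zeroes, where $\omega(N)$ is the number of prime divisors of $N$. -/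

import Mathlib

open scoped Quaternion RestrictedProduct

noncomputable section

namespace QMF

/-! ### Hecke operators on double coset spaces -/

section DoubleCosets

variable {G : Type*} [Group G]

/-- The set of left cosets `βK` contained in `KgK`, i.e. `KgK / K`. -/
def cosetsIn (K : Subgroup G) (g : G) : Set (G ⧸ K) :=
  {c | ∃ k ∈ K, c = ((k * g : G) : G ⧸ K)}

variable {H K : Subgroup G}

/-- For `φ : H \ G / K → ℂ`, `x ∈ G` and a coset `c = βK`, the value `φ(xβ)`
(it does not depend on the representative `β`). -/
def evalCoset (φ : DoubleCoset.Quotient (H : Set G) (K : Set G) → ℂ) (x : G) (c : G ⧸ K) : ℂ :=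
  Quotient.liftOn' c (fun β => φ (DoubleCoset.mk H K (x * β))) (by
    intro β γ h
    rw [QuotientGroup.leftRel_apply] at h
    refine congrArg φ ((DoubleCoset.eq H K _ _).2 ⟨1, H.one_mem, _, h, ?_⟩)
    group)

lemma evalCoset_coe (φ : DoubleCoset.Quotient (H : Set G) (K : Set G) → ℂ) (x β : G) :
    evalCoset φ x (β : G ⧸ K) = φ (DoubleCoset.mk H K (x * β)) := rfl

/-- The Hecke operator `(T_g φ)(x) = ∑ φ(xβ)`, the sum over representatives `β` of `KgK / K`. -/
def heckeT (g : G) (φ : DoubleCoset.Quotient (H : Set G) (K : Set G) → ℂ) :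
    DoubleCoset.Quotient (H : Set G) (K : Set G) → ℂ :=
  fun q => Quotient.liftOn' q (fun x => ∑ᶠ c : cosetsIn K g, evalCoset φ x c) (by
    intro x y hxy
    obtain ⟨h, hh, k, hk, rfl⟩ := DoubleCoset.rel_iff.1 hxy
    let e : cosetsIn K g ≃ cosetsIn K g :=
      { toFun := fun c => ⟨k • c.1, by
          obtain ⟨c, l, hl, rfl⟩ := c
          exact ⟨k * l, K.mul_mem hk hl, by simp [mul_assoc]⟩⟩
        invFun := fun c => ⟨k⁻¹ • c.1, by
          obtain ⟨c, l, hl, rfl⟩ := c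
          exact ⟨k⁻¹ * l, K.mul_mem (K.inv_mem hk) hl, by simp [mul_assoc]⟩⟩
        left_inv := fun c => by simp
        right_inv := fun c => by simp }
    symm
    refine finsum_eq_of_bijective e e.bijective ?_
    rintro ⟨c, l, hl, rfl⟩
    show φ _ = φ _
    refine congrArg φ ((DoubleCoset.eq H K _ _).2 ⟨h⁻¹, H.inv_mem hh, 1, K.one_mem, ?_⟩)
    simp [mul_assoc])

/-- If `g` normalizes `K` then `T_g φ (x) = φ(xg)`. -/
lemma heckeT_of_normalizer {g : G} (hg : ∀ k ∈ K, g⁻¹ * k * g ∈ K)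
    (φ : DoubleCoset.Quotient (H : Set G) (K : Set G) → ℂ) (x : G) :
    heckeT g φ (DoubleCoset.mk H K x) = φ (DoubleCoset.mk H K (x * g)) := by
  have hc : ∀ c : cosetsIn K g, c = ⟨(g : G ⧸ K), 1, K.one_mem, by simp⟩ := by
    rintro ⟨c, l, hl, rfl⟩
    refine Subtype.ext (QuotientGroup.eq.2 ?_)
    have := hg _ (K.inv_mem hl)
    simpa [mul_assoc] using this
  show ∑ᶠ c : cosetsIn K g, evalCoset φ x c = _
  rw [finsum_eq_single _ ⟨(g : G ⧸ K), 1, K.one_mem, by simp⟩ (fun c hne => absurd (hc c) hne)]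
  rfl

/-- Right multiplication by an element normalizing `K`, as a map on `H \ G / K`. -/
def rightMul (g : G) (hg : ∀ k ∈ K, g⁻¹ * k * g ∈ K) :
    DoubleCoset.Quotient (H : Set G) (K : Set G) → DoubleCoset.Quotient (H : Set G) (K : Set G) :=
  fun q => Quotient.liftOn' q (fun x => DoubleCoset.mk H K (x * g)) (by
    intro x y hxy
    obtain ⟨h, hh, k, hk, rfl⟩ := DoubleCoset.rel_iff.1 hxy
    refine (DoubleCoset.eq H K _ _).2 ⟨h, hh, _, hg k hk, ?_⟩
    group)

end DoubleCosets

/-! ### Quaternion algebras over `ℚ`, orders, localizations -/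

instance factPrime (p : Nat.Primes) : Fact (p : ℕ).Prime := ⟨p.2⟩

/-- The completion `B_p = B ⊗ ℚ_p` of the quaternion algebra `B = (a, b / ℚ)`. -/
abbrev Bp (a b : ℚ) (p : Nat.Primes) : Type := ℍ[ℚ_[p], (a : ℚ_[p]), (b : ℚ_[p])]

/-- The embedding `B → B_p`. -/
def toBp (a b : ℚ) (p : Nat.Primes) : ℍ[ℚ, a, b] →+* Bp a b p where
  toFun x := ⟨x.re, x.imI, x.imJ, x.imK⟩
  map_one' := by ext <;> simp
  map_zero' := by ext <;> simp
  map_mul' x y := by ext <;> simp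
  map_add' x y := by ext <;> simp

/-- The reduced norm `x ↦ x x̄` on `B_p`. -/
def nrd {a b : ℚ} {p : Nat.Primes} (x : Bp a b p) : ℚ_[p] := (x * star x).re

/-- `p` ramifies in `B` if `B_p` is a division algebra. -/
def IsRamified (a b : ℚ) (p : Nat.Primes) : Prop := ∀ x : Bp a b p, x ≠ 0 → IsUnit x

/-- The discriminant of `B`: the product of the finite primes ramified in `B`. It is also the level
`N` of the maximal orders of `B`. -/
def disc (a b : ℚ) : ℕ := ∏ᶠ p : {p : Nat.Primes // IsRamified a b p}, (p.1 : ℕ)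

variable {a b : ℚ}

/-- Orders in `B`: subrings that are full `ℤ`-lattices. -/
def IsOrder (O : Subring ℍ[ℚ, a, b]) : Prop :=
  O.toAddSubgroup.FG ∧ Submodule.span ℚ (O : Set ℍ[ℚ, a, b]) = ⊤

/-- Maximal orders in `B`. -/
def IsMaximalOrder (O : Subring ℍ[ℚ, a, b]) : Prop := Maximal IsOrder O

/-- The localization `O_p = O ⊗ ℤ_p ⊆ B_p`, the `ℤ_p`-subalgebra generated by the image of `O`. -/
def Op (O : Subring ℍ[ℚ, a, b]) (p : Nat.Primes) : Subalgebra ℤ_[p] (Bp a b p) :=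
  Algebra.adjoin ℤ_[p] (toBp a b p '' (O : Set ℍ[ℚ, a, b]))

/-- `O_pˣ` as a subgroup of `B_pˣ`. -/
def OpUnits (O : Subring ℍ[ℚ, a, b]) (p : Nat.Primes) : Subgroup (Bp a b p)ˣ :=
  (Op O p).toSubmonoid.units

/-- `B̂ˣ`, the restricted product of the `B_pˣ` with respect to the `O_pˣ`. -/
abbrev Bhat (O : Subring ℍ[ℚ, a, b]) : Type :=
  Πʳ p : Nat.Primes, [(Bp a b p)ˣ, OpUnits O p]

/-- `Ôˣ = ∏ O_pˣ` as a subgroup of `B̂ˣ`. -/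
def Ohat (O : Subring ℍ[ℚ, a, b]) : Subgroup (Bhat O) where
  carrier := {x | ∀ p, x p ∈ OpUnits O p}
  mul_mem' hx hy p := (OpUnits O p).mul_mem (hx p) (hy p)
  one_mem' p := (OpUnits O p).one_mem
  inv_mem' hx p := (OpUnits O p).inv_mem (hx p)

/-- `Bˣ` diagonally embedded in `B̂ˣ`. -/
def diagB (O : Subring ℍ[ℚ, a, b]) : Subgroup (Bhat O) where
  carrier := {x | ∃ β : (ℍ[ℚ, a, b])ˣ, ∀ p, x p = Units.map (toBp a b p).toMonoidHom β}
  mul_mem' := by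
    rintro x y ⟨β, hβ⟩ ⟨γ, hγ⟩
    exact ⟨β * γ, fun p => by rw [map_mul, ← hβ, ← hγ]; rfl⟩
  one_mem' := ⟨1, fun p => by rw [map_one]; rfl⟩
  inv_mem' := by
    rintro x ⟨β, hβ⟩
    exact ⟨β⁻¹, fun p => by rw [map_inv, ← hβ]; rfl⟩

/-- `Cl(O) = Bˣ \ B̂ˣ / Ôˣ`, the set of invertible right `O`-ideal classes. -/
abbrev Cl (O : Subring ℍ[ℚ, a, b]) : Type :=
  DoubleCoset.Quotient (diagB O : Set (Bhat O)) (Ohat O : Set (Bhat O))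

/-- `M(O)`, the space of quaternionic modular forms of level `O`. -/
abbrev M (O : Subring ℍ[ℚ, a, b]) : Type := Cl O → ℂ

/-! ### Hecke operators, eigenforms, degree -/

/-- The set of `x ∈ Ô ∩ B̂ˣ` whose reduced norm generates `n Ẑ`. -/
def normSet (O : Subring ℍ[ℚ, a, b]) (n : ℕ) : Set (Bhat O) :=
  {x | ∀ p, ((x p : (Bp a b p)ˣ) : Bp a b p) ∈ Op O p ∧
    ‖nrd ((x p : (Bp a b p)ˣ) : Bp a b p)‖ = ‖(n : ℚ_[p])‖}

/-- The double cosets `Ôˣ α Ôˣ` that make up `normSet O n`. -/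
def normDoubleCosets (O : Subring ℍ[ℚ, a, b]) (n : ℕ) :
    Set (DoubleCoset.Quotient (Ohat O : Set (Bhat O)) (Ohat O : Set (Bhat O))) :=
  DoubleCoset.mk (Ohat O) (Ohat O) '' normSet O n

/-- `T_n = ∑ T_α`, with `α` over representatives of the double cosets in `normSet O n`. -/
def heckeTn (O : Subring ℍ[ℚ, a, b]) (n : ℕ) (φ : M O) : M O :=
  fun x => ∑ᶠ D : normDoubleCosets O n, heckeT D.1.out φ x

/-- An eigenform: a nonzero simultaneous eigenvector of all `T_p`, `p ∤ N`. -/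
def IsEigenform (O : Subring ℍ[ℚ, a, b]) (φ : M O) : Prop :=
  φ ≠ 0 ∧ ∀ p : ℕ, p.Prime → ¬ p ∣ disc a b → ∃ l : ℂ, heckeTn O p φ = l • φ

/-- The rationality field `K_φ`, generated over `ℚ` by all Hecke eigenvalues of `φ`. -/
def ratField (O : Subring ℍ[ℚ, a, b]) (φ : M O) : IntermediateField ℚ ℂ :=
  IntermediateField.adjoin ℚ {l : ℂ | ∃ n : ℕ, 0 < n ∧ heckeTn O n φ = l • φ}

/-- The degree `[K_φ : ℚ]`. -/
def degree (O : Subring ℍ[ℚ, a, b]) (φ : M O) : ℕ∞ :=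
  Cardinal.toENat (Module.rank ℚ (ratField O φ))

/-! ### Local involutions and sign patterns -/

/-- The primes dividing the level. -/
abbrev LevelPrimes (a b : ℚ) : Type := {p : Nat.Primes // (p : ℕ) ∣ disc a b}

/-- `ϖ` is a uniformizer of the (possibly noncommutative) ring `R`: the non-units of `R` are
the elements of `ϖ R`, and also the elements of `R ϖ`. -/
def IsUniformizer {R : Type*} [Ring R] (ϖ : R) : Prop :=
  nonunits R = Set.range (fun y => ϖ * y) ∧ nonunits R = Set.range (fun y => y * ϖ)

/-- A choice, for every `p ∣ N`, of a uniformizer `ϖ_p ∈ O_p` with `ϖ_p² = p`. -/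
structure Uniformizers (O : Subring ℍ[ℚ, a, b]) where
  elt : ∀ p : LevelPrimes a b, Op O p.1
  isUniformizer : ∀ p, IsUniformizer (elt p)
  sq : ∀ p, elt p * elt p = ((p.1 : ℕ) : Op O p.1)

namespace Uniformizers

variable {O : Subring ℍ[ℚ, a, b]} (ϖ : Uniformizers O)

/-- `ϖ_p` as an element of `B_pˣ`; its inverse is `ϖ_p / p`. -/
def unit (p : LevelPrimes a b) : (Bp a b p.1)ˣ where
  val := ϖ.elt p
  inv := ((p.1 : ℕ) : ℚ_[p.1])⁻¹ • (ϖ.elt p : Bp a b p.1)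
  val_inv := by
    have h := congrArg (Subtype.val) (ϖ.sq p)
    have hp : ((p.1 : ℕ) : ℚ_[p.1]) ≠ 0 := by exact_mod_cast p.1.2.ne_zero
    have h' : (ϖ.elt p : Bp a b p.1) * (ϖ.elt p : Bp a b p.1)
        = algebraMap ℚ_[p.1] _ ((p.1 : ℕ) : ℚ_[p.1]) := by
      rw [map_natCast]; simpa using h
    rw [mul_smul_comm, h', Algebra.smul_def, ← map_mul, inv_mul_cancel₀ hp, map_one]
  inv_val := by
    have h := congrArg (Subtype.val) (ϖ.sq p)
    have hp : ((p.1 : ℕ) : ℚ_[p.1]) ≠ 0 := by exact_mod_cast p.1.2.ne_zero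
    have h' : (ϖ.elt p : Bp a b p.1) * (ϖ.elt p : Bp a b p.1)
        = algebraMap ℚ_[p.1] _ ((p.1 : ℕ) : ℚ_[p.1]) := by
      rw [map_natCast]; simpa using h
    rw [smul_mul_assoc, h', Algebra.smul_def, ← map_mul, inv_mul_cancel₀ hp, map_one]

open Classical in
/-- `ϖ̂_p = (1, …, 1, ϖ_p, 1, …) ∈ B̂ˣ`. -/
def hat (p : LevelPrimes a b) : Bhat O :=
  RestrictedProduct.mulSingle (OpUnits O) p.1 (ϖ.unit p)

lemma conj_mem (p : LevelPrimes a b) {u : (Bp a b p.1)ˣ}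
    (hu : (u : Bp a b p.1) ∈ Op O p.1) :
    (((ϖ.unit p)⁻¹ * u * ϖ.unit p : (Bp a b p.1)ˣ) : Bp a b p.1) ∈ Op O p.1 := by
  obtain ⟨h1, h2⟩ := ϖ.isUniformizer p
  have hmem : (⟨u, hu⟩ : Op O p.1) * ϖ.elt p ∈ nonunits (Op O p.1) := by
    rw [h2]; exact ⟨_, rfl⟩
  rw [h1] at hmem
  obtain ⟨y, hy⟩ := hmem
  have hy' : (ϖ.unit p : Bp a b p.1) * (y : Bp a b p.1) = u * ϖ.unit p :=
    congrArg Subtype.val hy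
  have : (((ϖ.unit p)⁻¹ * u * ϖ.unit p : (Bp a b p.1)ˣ) : Bp a b p.1) = y := by
    rw [Units.val_mul, Units.val_mul, mul_assoc, ← hy', Units.inv_mul_cancel_left]
  rw [this]; exact y.2

/-- `ϖ̂_p` normalizes `Ôˣ`. -/
lemma hat_normalizes (p : LevelPrimes a b) :
    ∀ k ∈ Ohat O, (ϖ.hat p)⁻¹ * k * ϖ.hat p ∈ Ohat O := by
  classical
  intro k hk q
  have e : ((ϖ.hat p)⁻¹ * k * ϖ.hat p) q = (ϖ.hat p q)⁻¹ * k q * ϖ.hat p q := rfl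
  rw [e]
  by_cases hq : q = p.1
  · subst hq
    have hs : ϖ.hat p p.1 = ϖ.unit p := by
      unfold hat; convert RestrictedProduct.mulSingle_eq_same (OpUnits O) p.1 (ϖ.unit p)
    rw [hs]
    have hkp : k p.1 ∈ (Op O p.1).toSubmonoid.units := hk p.1
    rw [Submonoid.mem_units_iff] at hkp
    show _ ∈ (Op O p.1).toSubmonoid.units
    rw [Submonoid.mem_units_iff]
    refine ⟨ϖ.conj_mem p hkp.1, ?_⟩
    have hinv : ((ϖ.unit p)⁻¹ * k p.1 * ϖ.unit p)⁻¹
        = (ϖ.unit p)⁻¹ * (k p.1)⁻¹ * ϖ.unit p := by group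
    rw [hinv]
    exact ϖ.conj_mem p hkp.2
  · have hs : ϖ.hat p q = 1 := by
      unfold hat; convert RestrictedProduct.mulSingle_eq_of_ne (OpUnits O) (ϖ.unit p) hq
    rw [hs]
    simpa using hk q

/-- The local involution `σ_p` on `Cl(O)`: right multiplication by `ϖ̂_p`. -/
def sigma (p : LevelPrimes a b) : Cl O → Cl O :=
  rightMul (ϖ.hat p) (ϖ.hat_normalizes p)

lemma heckeT_hat (p : LevelPrimes a b) (φ : M O) : heckeT (ϖ.hat p) φ = φ ∘ ϖ.sigma p := by
  funext x
  induction x using Quotient.inductionOn' with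
  | h x => exact heckeT_of_normalizer (ϖ.hat_normalizes p) φ x

end Uniformizers

/-- A sign pattern for `N`: a multiplicative function from the divisors of `N` to `{±1}`
(values of `ε` outside the divisors of `N` are never used). -/
def IsSignPattern (N : ℕ) (ε : ℕ → ℤˣ) : Prop :=
  ε 1 = 1 ∧ ∀ m n : ℕ, m * n ∣ N → m.Coprime n → ε (m * n) = ε m * ε n

variable {O : Subring ℍ[ℚ, a, b]} (ϖ : Uniformizers O) (ε : ℕ → ℤˣ)

/-- `M^ε(O) = {φ ∈ M(O) : T_{ϖ̂_p} φ = ε(p) φ for all p ∣ N}`. -/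
def Meps : Submodule ℂ (M O) where
  carrier := {φ | ∀ p : LevelPrimes a b, heckeT (ϖ.hat p) φ = ((ε (p.1 : ℕ) : ℤ) : ℂ) • φ}
  add_mem' := by
    intro φ ψ hφ hψ p
    have h1 := hφ p
    have h2 := hψ p
    rw [ϖ.heckeT_hat] at h1 h2 ⊢
    rw [smul_add, ← h1, ← h2]; rfl
  zero_mem' := by
    intro p
    rw [ϖ.heckeT_hat, smul_zero]; rfl
  smul_mem' := by
    intro c φ hφ p
    have h1 := hφ p
    rw [ϖ.heckeT_hat] at h1 ⊢
    rw [smul_comm, ← h1]; rfl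

/-- `SignedPath ϖ ε x y s`: there is a path from `x` to `y` of parity `s` in the signed multigraph
on `Cl(O)` that has, for every `p ∣ N`, an edge of sign `ε(p)` between `x` and `σ_p(x)`. -/
inductive SignedPath : Cl O → Cl O → ℤˣ → Prop
  | nil (x : Cl O) : SignedPath x x 1
  | cons (p : LevelPrimes a b) {x y z : Cl O} {s : ℤˣ}
      (edge : y = ϖ.sigma p x ∨ x = ϖ.sigma p y) (path : SignedPath y z s) :
      SignedPath x z (ε (p.1 : ℕ) * s)

/-- `x` and `y` are in the same orbit of `Pic(O)`, i.e. of the group generated by the `σ_p`,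
`p ∣ N`. -/
def SameOrbit (x y : Cl O) : Prop :=
  Relation.EqvGen (fun u v => ∃ p : LevelPrimes a b, v = ϖ.sigma p u) x y

/-- The orbit of `x` is `ε`-admissible: no cycle in it has parity `-1`. -/
def Admissible (x : Cl O) : Prop :=
  ∀ y, SameOrbit ϖ x y → ¬ SignedPath ϖ ε y y (-1)

/-- `F` is a set of representatives for the `ε`-admissible orbits. -/
def IsFundDomain (F : Set (Cl O)) : Prop :=
  (∀ x ∈ F, Admissible ϖ ε x) ∧ ∀ x, Admissible ϖ ε x → ∃! y, y ∈ F ∧ SameOrbit ϖ x y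

end QMF

end

/-! The Hecke operators have rational coefficients, so a `ℚ`-space `I` containing all values of `φ`
contains `l * φ x` for every eigenvalue `l`. If `I` is spanned by finitely many values, it is
therefore stable under `K_φ`. It contains the line `K_φ · φ x` for some `φ x ≠ 0`, so the number of
spanning values is at least the degree `d` (`degree_le_encard`). For `φ` in `M^ε(O)`, values along
an orbit agree up to sign and vanish on inadmissible orbits, so the nonzero values on a fundamental
domain `F` span `I` (`apply_mem_span`). Hence at least `d` points of `F` are not zeros. For the
second bound, nontrivial zeros fill whole orbits, each of size at most `2 ^ ω(N)` because the `σ_p`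
are commuting involutions (`encard_orbit_le`), and signed indicator functions of admissible orbits
give `#F ≤ dim M^ε(O)` (`IsFundDomain.encard_le_rank`). -/

noncomputable section

namespace QMF

/-! ### Rationality: the values of an eigenfunction span a vector space over its Hecke field -/

/-- A `ℚ`-subspace of `ℂ` containing all values of `φ` contains all values of `T_n φ`. -/
lemma heckeTn_apply_mem {a b : ℚ} {O : Subring ℍ[ℚ, a, b]} {φ : M O} {I : Submodule ℚ ℂ}
    (hI : ∀ x, φ x ∈ I) (n : ℕ) (x : Cl O) : heckeTn O n φ x ∈ I := by
  -- A `finsum` of infinite support is `0`, which lies in `I`, so no finiteness of the coset sets is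
  -- needed.
  refine finsum_induction (· ∈ I) I.zero_mem (fun _ _ => I.add_mem) fun D => ?_
  induction x using Quotient.inductionOn' with
  | h x =>
    refine finsum_induction (· ∈ I) I.zero_mem (fun _ _ => I.add_mem) ?_
    rintro ⟨c, _⟩
    induction c using Quotient.inductionOn' with
    | h c => exact hI _

/-- The scalars preserving a finite-dimensional subspace of a field extension form a subfield. -/
lemma mul_mem_of_mem_adjoin {K L : Type*} [Field K] [Field L] [Algebra K L]
    {I : Submodule K L} [FiniteDimensional K I] {S : Set L}
    (hS : ∀ l ∈ S, ∀ v ∈ I, l * v ∈ I) {k : L} (hk : k ∈ IntermediateField.adjoin K S) :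
    ∀ v ∈ I, k * v ∈ I := by
  induction hk using IntermediateField.adjoin_induction with
  | mem l hl => exact hS l hl
  | algebraMap q =>
    intro v hv
    rw [← Algebra.smul_def]
    exact I.smul_mem q hv
  | add k l _ _ hk hl =>
    intro v hv
    rw [add_mul]
    exact I.add_mem (hk v hv) (hl v hv)
  | mul k l _ _ hk hl =>
    intro v hv
    rw [mul_assoc]
    exact hk _ (hl v hv)
  | inv k _ hk =>
    intro v hv
    rcases eq_or_ne k 0 with rfl | h0
    · simp
    -- Multiplication by `k ≠ 0` is injective on the finite-dimensional `I`, hence surjective: `v`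
    -- is `k * w` with `w ∈ I`.
    let f : I →ₗ[K] I := (LinearMap.mulLeft K k).restrict hk
    have hf : Function.Injective f := fun u w huw =>
      Subtype.ext (mul_left_cancel₀ h0 (congrArg Subtype.val huw))
    obtain ⟨w, hw⟩ := LinearMap.injective_iff_surjective.1 hf ⟨v, hv⟩
    have hw' : k * (w : L) = v := congrArg Subtype.val hw
    rw [← hw', inv_mul_cancel_left₀ h0]
    exact w.2

/-- If the values of `φ ≠ 0` on `S` span all values of `φ` over `ℚ`, then `S` has at least
`[K_φ : ℚ]` elements. -/
lemma degree_le_encard {a b : ℚ} {O : Subring ℍ[ℚ, a, b]} {φ : M O} (hφ : φ ≠ 0) {S : Set (Cl O)}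
    (hS : ∀ x, φ x ∈ Submodule.span ℚ (φ '' S)) : degree O φ ≤ S.encard := by
  rcases S.finite_or_infinite with hfin | hinf
  swap
  · simp [hinf.encard_eq]
  set I := Submodule.span ℚ (φ '' S) with hIdef
  have : FiniteDimensional ℚ I := FiniteDimensional.span_of_finite ℚ (hfin.image φ)
  obtain ⟨x, hx⟩ := Function.ne_iff.1 hφ
  have hgen : ∀ l ∈ {l : ℂ | ∃ n : ℕ, 0 < n ∧ heckeTn O n φ = l • φ}, ∀ v ∈ I, l * v ∈ I := by
    rintro l ⟨n, -, hl⟩ v hv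
    induction hv using Submodule.span_induction with
    | mem v hv =>
      obtain ⟨y, -, rfl⟩ := hv
      have h : heckeTn O n φ y = l * φ y := congrFun hl y
      rw [← h]
      exact heckeTn_apply_mem hS n y
    | zero => simp
    | add u w _ _ hu hw =>
      rw [mul_add]
      exact I.add_mem hu hw
    | smul q u _ hu =>
      rw [mul_smul_comm]
      exact I.smul_mem q hu
  -- The map `k ↦ k * φ x` embeds `K_φ` in `I`.
  let f : ratField O φ →ₗ[ℚ] I :=
    ((LinearMap.mulRight ℚ (φ x)).comp (ratField O φ).val.toLinearMap).codRestrict I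
      fun k => mul_mem_of_mem_adjoin hgen k.2 _ (hS x)
  have hf : Function.Injective f := fun k l hkl =>
    Subtype.ext (mul_right_cancel₀ hx (congrArg Subtype.val hkl))
  calc degree O φ ≤ Cardinal.toENat (Cardinal.mk (φ '' S)) :=
        OrderHomClass.mono Cardinal.toENat
          ((LinearMap.rank_le_of_injective f hf).trans (rank_span_le _))
    _ ≤ S.encard := Set.encard_image_le φ S

/-! ### The local involutions -/

/-- A rational prime is a unit of `O_q` for every other prime `q`. -/
lemma natCast_mem_OpUnits {a b : ℚ} (O : Subring ℍ[ℚ, a, b]) {p q : Nat.Primes} (h : q ≠ p)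
    (u : (Bp a b q)ˣ) (hu : (u : Bp a b q) = ((p : ℕ) : Bp a b q)) : u ∈ OpUnits O q := by
  show u ∈ (Op O q).toSubmonoid.units
  rw [Submonoid.mem_units_iff]
  have hc : ((p : ℕ) : ℤ_[q]) * ((p : ℕ) : ℤ_[q]).inv = 1 := by
    refine PadicInt.mul_inv ?_
    rw [PadicInt.norm_def, PadicInt.coe_natCast, Padic.norm_natCast_eq_one_iff]
    exact (Nat.coprime_primes q.2 p.2).2 fun e => h (Subtype.ext e)
  have hi : ((u⁻¹ : (Bp a b q)ˣ) : Bp a b q)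
      = algebraMap ℤ_[q] (Bp a b q) ((p : ℕ) : ℤ_[q]).inv := by
    refine Units.inv_eq_of_mul_eq_one_right ?_
    rw [hu, ← map_natCast (algebraMap ℤ_[q] (Bp a b q)), ← map_mul, hc, map_one]
  refine ⟨?_, ?_⟩
  · rw [hu]
    exact natCast_mem (Op O q) _
  · rw [hi]
    exact (Op O q).algebraMap_mem _

/-- A rational prime, as a unit of `B`. -/
def primeUnit (a b : ℚ) (p : Nat.Primes) : (ℍ[ℚ, a, b])ˣ :=
  Units.map (algebraMap ℚ ℍ[ℚ, a, b]).toMonoidHom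
    (Units.mk0 ((p : ℕ) : ℚ) (by exact_mod_cast p.2.ne_zero))

lemma coe_map_primeUnit (a b : ℚ) (p q : Nat.Primes) :
    (Units.map (toBp a b q).toMonoidHom (primeUnit a b p) : Bp a b q) = ((p : ℕ) : Bp a b q) := by
  show toBp a b q (algebraMap ℚ ℍ[ℚ, a, b] ((p : ℕ) : ℚ)) = _
  rw [map_natCast, map_natCast]

/-- A rational prime, diagonally embedded in `B̂ˣ`. -/
def primeHat {a b : ℚ} (O : Subring ℍ[ℚ, a, b]) (p : Nat.Primes) : Bhat O :=
  ⟨fun q => Units.map (toBp a b q).toMonoidHom (primeUnit a b p), by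
    refine Filter.mem_of_superset (Set.finite_singleton p).compl_mem_cofinite fun q hq => ?_
    exact natCast_mem_OpUnits O hq _ (coe_map_primeUnit a b p q)⟩

lemma coe_primeHat_apply {a b : ℚ} (O : Subring ℍ[ℚ, a, b]) (p q : Nat.Primes) :
    ((primeHat O p q : (Bp a b q)ˣ) : Bp a b q) = ((p : ℕ) : Bp a b q) :=
  coe_map_primeUnit a b p q

lemma primeHat_commute {a b : ℚ} (O : Subring ℍ[ℚ, a, b]) (p : Nat.Primes) (x : Bhat O) :
    Commute (primeHat O p) x := by
  refine RestrictedProduct.ext _ _ fun q => Units.ext ?_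
  show ((primeHat O p q : (Bp a b q)ˣ) : Bp a b q) * (x q : (Bp a b q)ˣ)
    = (x q : (Bp a b q)ˣ) * ((primeHat O p q : (Bp a b q)ˣ) : Bp a b q)
  rw [coe_primeHat_apply]
  exact Nat.cast_commute _ _

namespace Uniformizers

variable {a b : ℚ} {O : Subring ℍ[ℚ, a, b]} (ϖ : Uniformizers O)

lemma hat_apply_self (p : LevelPrimes a b) : ϖ.hat p p.1 = ϖ.unit p := by
  classical
  unfold hat
  convert RestrictedProduct.mulSingle_eq_same (OpUnits O) p.1 (ϖ.unit p)

lemma hat_apply_of_ne (p : LevelPrimes a b) {q : Nat.Primes} (hq : q ≠ p.1) :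
    ϖ.hat p q = 1 := by
  classical
  unfold hat
  convert RestrictedProduct.mulSingle_eq_of_ne (OpUnits O) (ϖ.unit p) hq

lemma hat_commute (p q : LevelPrimes a b) : Commute (ϖ.hat p) (ϖ.hat q) := by
  refine RestrictedProduct.ext _ _ fun r => ?_
  show ϖ.hat p r * ϖ.hat q r = ϖ.hat q r * ϖ.hat p r
  by_cases hp : r = p.1
  · by_cases hq : r = q.1
    · rw [Subtype.ext (hp.symm.trans hq)]
    · rw [ϖ.hat_apply_of_ne q hq, mul_one, one_mul]
  · rw [ϖ.hat_apply_of_ne p hp, mul_one, one_mul]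

lemma sigma_commute (p q : LevelPrimes a b) (x : Cl O) :
    ϖ.sigma p (ϖ.sigma q x) = ϖ.sigma q (ϖ.sigma p x) := by
  induction x using Quotient.inductionOn' with
  | h x =>
    show DoubleCoset.mk _ _ (x * ϖ.hat q * ϖ.hat p) = DoubleCoset.mk _ _ (x * ϖ.hat p * ϖ.hat q)
    rw [mul_assoc, mul_assoc, (ϖ.hat_commute p q).eq]

lemma inv_primeHat_mul_hat_mul_hat_mem (p : LevelPrimes a b) :
    (primeHat O p.1)⁻¹ * (ϖ.hat p * ϖ.hat p) ∈ Ohat O := by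
  intro q
  show (primeHat O p.1 q)⁻¹ * (ϖ.hat p q * ϖ.hat p q) ∈ OpUnits O q
  by_cases hq : q = p.1
  · subst hq
    have h : ϖ.unit p * ϖ.unit p = primeHat O p.1 p.1 := by
      refine Units.ext ?_
      rw [coe_primeHat_apply]
      exact congrArg Subtype.val (ϖ.sq p)
    rw [ϖ.hat_apply_self, h, inv_mul_cancel]
    exact one_mem _
  · rw [ϖ.hat_apply_of_ne p hq, mul_one, mul_one]
    exact inv_mem (natCast_mem_OpUnits O hq _ (coe_primeHat_apply O p.1 q))

/-- The square of `ϖ̂_p` is `p` at `p` and `1` elsewhere. It differs from the diagonal, central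
element `p ∈ Bˣ` only by units at the other primes, so it is absorbed by `Bˣ` on the left and `Ôˣ`
on the right. -/
lemma sigma_sigma (p : LevelPrimes a b) (x : Cl O) : ϖ.sigma p (ϖ.sigma p x) = x := by
  induction x using Quotient.inductionOn' with
  | h x =>
    show DoubleCoset.mk _ _ (x * ϖ.hat p * ϖ.hat p) = DoubleCoset.mk _ _ x
    symm
    refine (DoubleCoset.eq _ _ _ _).2 ⟨primeHat O p.1, ⟨primeUnit a b p.1, fun q => rfl⟩, _,
      ϖ.inv_primeHat_mul_hat_mul_hat_mem p, ?_⟩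
    rw [(primeHat_commute O p.1 x).eq]
    group

end Uniformizers

/-! ### Orbits -/

/-- An infinite `finprod` is `1`, so this holds without knowing that only finitely many primes
ramify. -/
lemma disc_ne_zero (a b : ℚ) : disc a b ≠ 0 :=
  finprod_induction (· ≠ 0) one_ne_zero (fun _ _ => mul_ne_zero) fun p => p.1.2.ne_zero

lemma levelPrimes_toNat_injective (a b : ℚ) :
    Function.Injective fun p : LevelPrimes a b =>
      (⟨p.1, Nat.mem_primeFactors.2 ⟨p.1.2, p.2, disc_ne_zero a b⟩⟩ :
        (disc a b).primeFactors) := fun _ _ h =>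
  Subtype.ext (Subtype.ext (Subtype.mk.inj h))

instance finite_levelPrimes (a b : ℚ) : Finite (LevelPrimes a b) :=
  Finite.of_injective _ (levelPrimes_toNat_injective a b)

/-- A set of size at most `2 ^ #T` stable under commuting involutions indexed by `T`. -/
lemma exists_stable_set {ι X : Type*} (s : ι → X → X) (hs : ∀ i x, s i (s i x) = x)
    (hc : ∀ i j x, s i (s j x) = s j (s i x)) (x : X) (T : Finset ι) :
    ∃ A : Set X, x ∈ A ∧ A.encard ≤ 2 ^ T.card ∧ ∀ i ∈ T, ∀ y ∈ A, s i y ∈ A := by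
  classical
  induction T using Finset.induction_on with
  | empty => exact ⟨{x}, rfl, by simp, by simp⟩
  | insert i T hi ih =>
    obtain ⟨A, hx, hA, hT⟩ := ih
    -- The new involution swaps the two halves, and the others preserve each half by commutativity.
    refine ⟨A ∪ s i '' A, Or.inl hx, ?_, ?_⟩
    · calc (A ∪ s i '' A).encard ≤ A.encard + A.encard :=
            (Set.encard_union_le _ _).trans (add_le_add le_rfl (Set.encard_image_le _ _))
        _ ≤ 2 ^ T.card + 2 ^ T.card := add_le_add hA hA
        _ = 2 ^ (insert i T).card := by
            rw [Finset.card_insert_of_notMem hi, pow_succ, mul_two]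
    · intro j hj y hy
      rcases Finset.mem_insert.1 hj with rfl | hj
      · rcases hy with hy | ⟨z, hz, rfl⟩
        · exact Or.inr ⟨y, hy, rfl⟩
        · exact Or.inl (by rwa [hs])
      · rcases hy with hy | ⟨z, hz, rfl⟩
        · exact Or.inl (hT j hj y hy)
        · exact Or.inr ⟨s j z, hT j hj z hz, hc i j z⟩

section Orbits

variable {a b : ℚ} {O : Subring ℍ[ℚ, a, b]} (ϖ : Uniformizers O) {ε : ℕ → ℤˣ}

lemma encard_orbit_le (x : Cl O) :
    {y | SameOrbit ϖ x y}.encard ≤ 2 ^ (disc a b).primeFactors.card := by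
  have := Fintype.ofFinite (LevelPrimes a b)
  obtain ⟨A, hx, hA, hT⟩ :=
    exists_stable_set ϖ.sigma ϖ.sigma_sigma ϖ.sigma_commute x Finset.univ
  have hiff : ∀ y z, SameOrbit ϖ y z → (y ∈ A ↔ z ∈ A) := by
    intro y z h
    induction h with
    | rel y z h =>
      obtain ⟨p, rfl⟩ := h
      refine ⟨hT p (Finset.mem_univ _) y, fun h => ?_⟩
      rw [← ϖ.sigma_sigma p y]
      exact hT p (Finset.mem_univ _) _ h
    | refl y => exact Iff.rfl
    | symm y z _ h => exact h.symm
    | trans y z w _ _ h h' => exact h.trans h'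
  refine (Set.encard_le_encard fun y hy => (hiff x y hy).1 hx).trans (hA.trans ?_)
  refine pow_le_pow_right₀ one_le_two ?_
  have := Fintype.card_le_of_injective _ (levelPrimes_toNat_injective a b)
  simpa using this

/-! ### Signed paths and admissibility -/

variable {ϖ}

lemma SameOrbit.symm {x y : Cl O} (h : SameOrbit ϖ x y) : SameOrbit ϖ y x :=
  Relation.EqvGen.symm _ _ h

lemma SameOrbit.trans {x y z : Cl O} (h : SameOrbit ϖ x y) (h' : SameOrbit ϖ y z) :
    SameOrbit ϖ x z :=
  Relation.EqvGen.trans _ _ _ h h'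

lemma sameOrbit_sigma (p : LevelPrimes a b) (x : Cl O) : SameOrbit ϖ x (ϖ.sigma p x) :=
  Relation.EqvGen.rel _ _ ⟨p, rfl⟩

lemma signedPath_sigma (p : LevelPrimes a b) (x : Cl O) :
    SignedPath ϖ ε x (ϖ.sigma p x) (ε (p.1 : ℕ)) := by
  simpa using SignedPath.cons p (Or.inl rfl) (SignedPath.nil (ϖ := ϖ) (ε := ε) (ϖ.sigma p x))

lemma SignedPath.trans {x y z : Cl O} {s t : ℤˣ} (h : SignedPath ϖ ε x y s)
    (h' : SignedPath ϖ ε y z t) : SignedPath ϖ ε x z (s * t) := by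
  induction h with
  | nil x => simpa using h'
  | cons p edge _ ih =>
    rw [mul_assoc]
    exact .cons p edge (ih h')

lemma SignedPath.symm {x y : Cl O} {s : ℤˣ} (h : SignedPath ϖ ε x y s) :
    SignedPath ϖ ε y x s := by
  induction h with
  | nil x => exact .nil x
  | cons p edge _ ih =>
    rw [mul_comm]
    refine ih.trans ?_
    simpa using SignedPath.cons p edge.symm (SignedPath.nil (ϖ := ϖ) (ε := ε) _)

lemma SignedPath.sameOrbit {x y : Cl O} {s : ℤˣ} (h : SignedPath ϖ ε x y s) :
    SameOrbit ϖ x y := by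
  induction h with
  | nil x => exact Relation.EqvGen.refl x
  | cons p edge _ ih =>
    rcases edge with rfl | rfl
    · exact (sameOrbit_sigma p _).trans ih
    · exact (sameOrbit_sigma p _).symm.trans ih

lemma SameOrbit.exists_signedPath (ε : ℕ → ℤˣ) {x y : Cl O} (h : SameOrbit ϖ x y) :
    ∃ s, SignedPath ϖ ε x y s := by
  induction h with
  | rel x y h =>
    obtain ⟨p, rfl⟩ := h
    exact ⟨_, signedPath_sigma p x⟩
  | refl x => exact ⟨1, .nil x⟩
  | symm x y _ h => exact h.imp fun _ => SignedPath.symm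
  | trans x y z _ _ h h' =>
    obtain ⟨s, h⟩ := h
    obtain ⟨t, h'⟩ := h'
    exact ⟨s * t, h.trans h'⟩

lemma Admissible.of_sameOrbit {x y : Cl O} (hx : Admissible ϖ ε x) (h : SameOrbit ϖ x y) :
    Admissible ϖ ε y := fun z hz => hx z (h.trans hz)

/-- Following one path and returning along the other would close up a cycle of parity `s * t = -1`.
-/
lemma Admissible.signedPath_unique {x y : Cl O} (hx : Admissible ϖ ε x) {s t : ℤˣ}
    (hs : SignedPath ϖ ε x y s) (ht : SignedPath ϖ ε x y t) : s = t := by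
  by_contra hne
  have hst : s * t = -1 := by
    rcases Int.units_eq_one_or s with rfl | rfl <;> rcases Int.units_eq_one_or t with rfl | rfl <;>
      simp_all
  have h := hs.trans ht.symm
  rw [hst] at h
  exact hx x (Relation.EqvGen.refl x) h

/-- A form in `M^ε(O)` transforms along paths by their parity. -/
lemma SignedPath.apply_eq {φ : M O} (hφ : φ ∈ Meps ϖ ε) {x y : Cl O} {s : ℤˣ}
    (h : SignedPath ϖ ε x y s) : φ x = ((s : ℤ) : ℂ) * φ y := by
  have key : ∀ (p : LevelPrimes a b) (x : Cl O),
      φ (ϖ.sigma p x) = ((ε (p.1 : ℕ) : ℤ) : ℂ) * φ x := fun p x => by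
    have h := hφ p
    rw [ϖ.heckeT_hat] at h
    exact congrFun h x
  induction h with
  | nil x => simp
  | @cons p x y z s edge _ ih =>
    have hxy : x = ϖ.sigma p y := by
      rcases edge with rfl | rfl
      · rw [ϖ.sigma_sigma]
      · rfl
    rw [hxy, key, ih]
    push_cast
    ring

/-- A closed path of parity `-1` at `y` forces `φ y = -φ y`, and this zero spreads over the orbit.
-/
lemma admissible_of_apply_ne_zero {φ : M O} (hφ : φ ∈ Meps ϖ ε) {x : Cl O} (hx : φ x ≠ 0) :
    Admissible ϖ ε x := by
  intro y hxy hy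
  obtain ⟨s, hs⟩ := hxy.exists_signedPath ε
  refine hx ?_
  have h := hy.apply_eq hφ
  have h0 : φ y = 0 := by
    push_cast at h
    linear_combination h / 2
  rw [hs.apply_eq hφ, h0, mul_zero]

lemma apply_eq_zero_iff_of_sameOrbit {φ : M O} (hφ : φ ∈ Meps ϖ ε) {x y : Cl O}
    (h : SameOrbit ϖ x y) : φ x = 0 ↔ φ y = 0 := by
  obtain ⟨s, hs⟩ := h.exists_signedPath ε
  rw [hs.apply_eq hφ]
  simp

/-- The values of `φ ∈ M^ε(O)` at its nonzero points in a fundamental domain span all values. -/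
lemma apply_mem_span {φ : M O} (hφ : φ ∈ Meps ϖ ε) {F : Set (Cl O)} (hF : IsFundDomain ϖ ε F)
    (x : Cl O) : φ x ∈ Submodule.span ℚ (φ '' {y | y ∈ F ∧ φ y ≠ 0}) := by
  by_cases hx : φ x = 0
  · rw [hx]
    exact zero_mem _
  obtain ⟨y, ⟨hyF, hxy⟩, -⟩ := hF.2 x (admissible_of_apply_ne_zero hφ hx)
  obtain ⟨s, hs⟩ := hxy.exists_signedPath ε
  have hy : φ y ≠ 0 := fun h => hx ((apply_eq_zero_iff_of_sameOrbit hφ hxy).2 h)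
  rw [hs.apply_eq hφ]
  -- The parity is `±1`, hence a rational scalar.
  have h := Submodule.smul_mem (Submodule.span ℚ (φ '' {y | y ∈ F ∧ φ y ≠ 0})) ((s : ℤ) : ℚ)
    (Submodule.subset_span ⟨y, ⟨hyF, hy⟩, rfl⟩)
  rw [Algebra.smul_def] at h
  simpa using h

lemma encard_zeros_add_degree_le {φ : M O} (h0 : φ ≠ 0) (hφ : φ ∈ Meps ϖ ε) {F : Set (Cl O)}
    (hF : IsFundDomain ϖ ε F) : {x | x ∈ F ∧ φ x = 0}.encard + degree O φ ≤ F.encard := by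
  refine (add_le_add le_rfl (degree_le_encard h0 (apply_mem_span hφ hF))).trans ?_
  rw [← Set.encard_union_eq (Set.disjoint_left.2 fun x hx hx' => hx'.2 hx.2)]
  exact Set.encard_le_encard (Set.union_subset (fun x hx => hx.1) fun x hx => hx.1)

/-! ### Fundamental domains and the dimension of `M^ε(O)` -/

variable (ϖ ε) in
lemma exists_isFundDomain : ∃ F, IsFundDomain ϖ ε F := by
  let S : Setoid (Cl O) := Relation.EqvGen.setoid fun u v => ∃ p, v = ϖ.sigma p u
  have hout : ∀ x, SameOrbit ϖ x (Quotient.mk S x).out := fun x =>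
    (show SameOrbit ϖ (Quotient.mk S x).out x from Quotient.mk_out (s := S) x).symm
  refine ⟨{x | Admissible ϖ ε x ∧ (Quotient.mk S x).out = x}, fun x hx => hx.1, fun x hx =>
    ⟨(Quotient.mk S x).out, ⟨⟨hx.of_sameOrbit (hout x), by simp⟩, hout x⟩, ?_⟩⟩
  rintro y ⟨⟨-, hy⟩, hxy⟩
  rw [← hy]
  exact congrArg Quotient.out (Quotient.sound (s := S) hxy.symm)

variable (ϖ ε) in
open Classical in
/-- The function supported on the orbit of `x`, whose value at `y` is the parity of a path from `x`
to `y`. -/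
def orbitFun (x : Cl O) : M O := fun y =>
  -- The chosen parity is independent of the path only when `x` is admissible.
  if h : ∃ s, SignedPath ϖ ε x y s then ((h.choose : ℤ) : ℂ) else 0

lemma Admissible.orbitFun_eq {x y : Cl O} (hx : Admissible ϖ ε x) {s : ℤˣ}
    (hs : SignedPath ϖ ε x y s) : orbitFun ϖ ε x y = ((s : ℤ) : ℂ) := by
  have h : ∃ s, SignedPath ϖ ε x y s := ⟨s, hs⟩
  rw [orbitFun, dif_pos h, hx.signedPath_unique h.choose_spec hs]

lemma orbitFun_eq_zero {x y : Cl O} (h : ¬ SameOrbit ϖ x y) : orbitFun ϖ ε x y = 0 :=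
  dif_neg fun ⟨_, hs⟩ => h hs.sameOrbit

/-- Extending a path by the edge from `y` to `σ_p y` multiplies its parity by `ε(p)`; off the orbit
both sides vanish. -/
lemma Admissible.orbitFun_mem {x : Cl O} (hx : Admissible ϖ ε x) :
    orbitFun ϖ ε x ∈ Meps ϖ ε := by
  intro p
  rw [ϖ.heckeT_hat]
  funext y
  show orbitFun ϖ ε x (ϖ.sigma p y) = _ * orbitFun ϖ ε x y
  by_cases h : SameOrbit ϖ x y
  · obtain ⟨s, hs⟩ := h.exists_signedPath ε
    rw [hx.orbitFun_eq hs, hx.orbitFun_eq (hs.trans (signedPath_sigma p y))]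
    push_cast
    ring
  · rw [orbitFun_eq_zero h, orbitFun_eq_zero fun h' => h (h'.trans (sameOrbit_sigma p y).symm),
      mul_zero]

/-- The `ε`-admissible orbits give linearly independent elements of `M^ε(O)`. -/
lemma IsFundDomain.encard_le_rank {F : Set (Cl O)} (hF : IsFundDomain ϖ ε F) :
    F.encard ≤ Cardinal.toENat (Module.rank ℂ (Meps ϖ ε)) := by
  let v : F → Meps ϖ ε := fun x => ⟨orbitFun ϖ ε x, (hF.1 x x.2).orbitFun_mem⟩
  -- Evaluating the family at the points of `F` gives the identity matrix.
  have hdiag : ∀ x : F, (v x).1 x = 1 := fun x => by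
    simpa using (hF.1 x x.2).orbitFun_eq (SignedPath.nil x.1)
  have hoff : ∀ x y : F, x ≠ y → (v x).1 y = 0 := fun x y hne => orbitFun_eq_zero fun h =>
    hne (Subtype.ext ((hF.2 x (hF.1 x x.2)).unique ⟨x.2, Relation.EqvGen.refl _⟩ ⟨y.2, h⟩))
  have hv : LinearIndependent ℂ v := by
    rw [linearIndependent_iff']
    intro s g hg x hx
    have h := congrFun (congrArg Subtype.val hg) x.1
    rw [AddSubmonoidClass.coe_finsetSum, Finset.sum_apply, Finset.sum_eq_single x] at h
    · simpa [hdiag] using h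
    · intro y _ hne
      simp [hoff y x hne]
    · exact fun h => absurd hx h
  exact OrderHomClass.mono Cardinal.toENat hv.cardinal_le_rank

lemma encard_nontrivial_zeros_le {φ : M O} (hφ : φ ∈ Meps ϖ ε) {F : Set (Cl O)}
    (hF : IsFundDomain ϖ ε F) :
    {x | Admissible ϖ ε x ∧ φ x = 0}.encard
      ≤ 2 ^ (disc a b).primeFactors.card * {x | x ∈ F ∧ φ x = 0}.encard := by
  set Z := {x | x ∈ F ∧ φ x = 0} with hZ
  rcases Z.finite_or_infinite with hfin | hinf
  swap
  -- The factor `2 ^ ω(N)` is nonzero, so the right-hand side is `⊤`.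
  · rw [hinf.encard_eq, ENat.mul_top (by simp)]
    exact le_top
  have hsub : {x | Admissible ϖ ε x ∧ φ x = 0}
      ⊆ ⋃ y ∈ hfin.toFinset, {x | SameOrbit ϖ y x} := by
    rintro x ⟨hx, hx0⟩
    obtain ⟨y, ⟨hyF, hxy⟩, -⟩ := hF.2 x hx
    simp only [Set.mem_iUnion]
    exact ⟨y, hfin.mem_toFinset.2 ⟨hyF, (apply_eq_zero_iff_of_sameOrbit hφ hxy).1 hx0⟩, hxy.symm⟩
  calc _ ≤ (⋃ y ∈ hfin.toFinset, {x | SameOrbit ϖ y x}).encard := Set.encard_le_encard hsub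
    _ ≤ ∑ y ∈ hfin.toFinset, {x | SameOrbit ϖ y x}.encard := Finset.set_encard_biUnion_le _ _
    _ ≤ ∑ _y ∈ hfin.toFinset, 2 ^ (disc a b).primeFactors.card :=
        Finset.sum_le_sum fun y _ => encard_orbit_le ϖ y
    _ = 2 ^ (disc a b).primeFactors.card * Z.encard := by
        rw [Finset.sum_const, nsmul_eq_mul, mul_comm, hfin.encard_eq_coe_toFinset_card]

end Orbits

end QMF

end

theorem corollary4p3 (a b : ℚ) (ha : a < 0) (hb : b < 0)
    (O : Subring ℍ[ℚ, a, b]) (hO : QMF.IsMaximalOrder O)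
    (ϖ : QMF.Uniformizers O)
    (ε : ℕ → ℤˣ) (hε : QMF.IsSignPattern (QMF.disc a b) ε)
    (φ : QMF.M O) (hφ : φ ∈ QMF.Meps ϖ ε) (heig : QMF.IsEigenform O φ) :
    (∀ F : Set (QMF.Cl O), QMF.IsFundDomain ϖ ε F →
      {x | x ∈ F ∧ φ x = 0}.encard + QMF.degree O φ ≤ F.encard) ∧
    {x | QMF.Admissible ϖ ε x ∧ φ x = 0}.encard
        + 2 ^ (QMF.disc a b).primeFactors.card * QMF.degree O φ
      ≤ 2 ^ (QMF.disc a b).primeFactors.card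
        * Cardinal.toENat (Module.rank ℂ (QMF.Meps ϖ ε)) := by
  refine ⟨fun F hF => QMF.encard_zeros_add_degree_le heig.1 hφ hF, ?_⟩
  -- The second bound does not mention `F`: any choice reduces it to `2 ^ ω(N)` times the first
  -- bound.
  obtain ⟨F, hF⟩ := QMF.exists_isFundDomain ϖ ε
  refine (add_le_add (QMF.encard_nontrivial_zeros_le hφ hF) le_rfl).trans ?_
  rw [← mul_add]
  exact mul_le_mul_right
    ((QMF.encard_zeros_add_degree_le heig.1 hφ hF).trans hF.encard_le_rank) _
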